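/- Let $(W,S)$ be a Coxeter system with finite generating set $S=\{s_1,\dots,s_n\}$ and Coxeter matrix $(m_{ij})$, where $m_{ii}=1$ and $m_{ij}=m_{ji}\in\{2,3,\dots\}\cup\{\infty\}$ for $i\neq j$. Let $\Gamma=(V,E)$ be its Coxeter graph: $V=S$, and distinct $s_i,s_j$ are joined by an edge if and only if $m_{ij}\neq 2$. Let $f$ be a legal weight function on $\Gamma$, that is, a function from the directed edges of $\Gamma$ to $\mathbb C\setminus\{0\}$ with $f((s_i,s_j))=f((s_j,s_i))^{-1}$ for every edge $\{s_i,s_j\}\in E$. The weight of a path in $\Gamma$ is the product of the weights of the directed edges it traverses, and the weighted Coxeter graph $\Gamma_f=(V,E,f)$ is called balanced if every closed path has weight $1$. For each $i$ let $\omega_i\in GL_n(\mathbb C)$ be the matrix that differs from the identity matrix only in its $i$-th row, whose entry in position $(i,i)$ is $-1$ and whose entry in position $(i,j)$, $j\neq i$, is $f((s_i,s_j))\cdot 2\cos(\pi/m_{ij})$ if $s_i$ and $s_j$ are joined by an edge (with $2\cos(\pi/m_{ij})=2$ when $m_{ij}=\infty$) and $0$ otherwise. The assignment $s_i\mapsto\omega_i$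 extends uniquely to a group homomorphism $\mathcal R_{\Gamma,f}\colon W\to GL_n(\mathbb C)$. If $\Gamma_f$ is balanced, then the representation $\mathcal R_{\Gamma,f}$ is faithful, i.e. the homomorphism $\mathcal R_{\Gamma,f}\colon W\to GL_n(\mathbb C)$ is injective. -/

import Mathlib

/-- The Coxeter graph of a Coxeter matrix `M` (without its labels): the vertices are the indices of
the generators, and two distinct vertices are joined by an edge iff `m_{ij} ≠ 2`, that is, iff
`m_{ij} ≥ 3` or `m_{ij} = ∞` (Mathlib encodes `m_{ij} = ∞` as `M i j = 0`). -/
def CoxeterMatrix.coxeterGraph {B : Type*} (M : CoxeterMatrix B) : SimpleGraph B where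
  Adj i j := i ≠ j ∧ M i j ≠ 2
  symm := ⟨fun i j h => ⟨h.1.symm, by rw [M.symmetric]; exact h.2⟩⟩
  loopless := ⟨fun _ h => h.1 rfl⟩

/-- A legal weight function on the Coxeter graph of `M`: a function from the directed edges (darts)
to the nonzero complex numbers whose values on opposite darts are inverse to each other. -/
structure LegalWeight {B : Type*} (M : CoxeterMatrix B) where
  toFun : M.coxeterGraph.Dart → ℂˣ
  map_symm : ∀ d : M.coxeterGraph.Dart, toFun d.symm = (toFun d)⁻¹

namespace LegalWeight

variable {B : Type*} {M : CoxeterMatrix B} (f : LegalWeight M)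

/-- The weight of a path: the product of the weights of the directed edges it traverses. -/
def pathWeight {i j : B} (p : M.coxeterGraph.Walk i j) : ℂˣ :=
  (p.darts.map f.toFun).prod

/-- The weighted graph is balanced if every closed path has weight `1`. -/
def IsBalanced : Prop :=
  ∀ (i : B) (p : M.coxeterGraph.Walk i i), f.pathWeight p = 1

end LegalWeight

/-- The number `2 cos (π / m_{ij})`, which is `2` when `m_{ij} = ∞`. -/
noncomputable def CoxeterMatrix.twoCos {B : Type*} (M : CoxeterMatrix B) (i j : B) : ℝ :=
  if M i j = 0 then 2 else 2 * Real.cos (Real.pi / (M i j : ℝ))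

namespace LegalWeight

open Classical in
/-- The entry `k_{ij} = f(s_i, s_j) * 2 cos (π / m_{ij})` if `s_i` and `s_j` are joined by an edge,
and `0` if they are not. -/
noncomputable def coeff {B : Type*} {M : CoxeterMatrix B} (f : LegalWeight M) (i j : B) : ℂ :=
  if h : M.coxeterGraph.Adj i j then (f.toFun ⟨(i, j), h⟩ : ℂ) * (M.twoCos i j : ℂ) else 0

/-- The matrix `ω_i`: it differs from the identity only in the `i`-th row, which has `-1` at
position `i` and `k_{ij}` at position `j ≠ i`. -/
noncomputable def omega {B : Type*} [DecidableEq B] {M : CoxeterMatrix B} (f : LegalWeight M)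
    (i : B) : Matrix B B ℂ :=
  Matrix.updateRow 1 i (fun j => if j = i then -1 else f.coeff i j)

section relations

variable {B : Type*} {M : CoxeterMatrix B} (f : LegalWeight M)

theorem coeff_self (i : B) : f.coeff i i = 0 := by
  simp [coeff]

theorem coeff_of_two {i j : B} (h : M i j = 2) : f.coeff i j = 0 := by
  rw [coeff, dif_neg]
  exact fun h' => h'.2 h

theorem coeff_mul_coeff {i j : B} (h : M.coxeterGraph.Adj i j) :
    f.coeff i j * f.coeff j i = (M.twoCos i j : ℂ) ^ 2 := by
  have hs : M.twoCos j i = M.twoCos i j := by simp [CoxeterMatrix.twoCos, M.symmetric j i]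
  have hf : f.toFun ⟨(j, i), h.symm⟩ = (f.toFun ⟨(i, j), h⟩)⁻¹ := f.map_symm ⟨(i, j), h⟩
  rw [coeff, coeff, dif_pos h, dif_pos h.symm, hs, hf]
  have := (f.toFun ⟨(i, j), h⟩).mul_inv
  linear_combination (M.twoCos i j : ℂ) ^ 2 * this

variable [Fintype B] [DecidableEq B]

/-- The linear form `φ_i` with `ω_i v = v - φ_i(v) e_i`. -/
noncomputable def form (i : B) : Module.Dual ℂ (B → ℂ) :=
  (2 : ℂ) • LinearMap.proj i - ∑ j, f.coeff i j • LinearMap.proj j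

theorem form_single (i j : B) :
    f.form i (Pi.single j 1) = (if i = j then 2 else 0) - f.coeff i j := by
  simp [form, Pi.single_apply]

theorem form_self (i : B) : f.form i (Pi.single i 1) = 2 := by
  simp [form_single, coeff_self]

theorem toLin_omega (i : B) :
    Matrix.toLin' (f.omega i) = (Module.reflection (f.form_self i)).toLinearMap := by
  ext j k
  by_cases hk : k = i
  · subst hk
    by_cases hj : j = k
    · subst hj
      simp [omega]
    · simp [omega, Module.reflection_apply, form_single, hj, Ne.symm hj]
  · simp [omega, Module.reflection_apply, hk, Matrix.one_apply, Pi.single_apply]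

theorem omega_mul_self (i : B) : f.omega i * f.omega i = 1 := by
  apply Matrix.toLin'.injective
  rw [Matrix.toLin'_mul, toLin_omega, Matrix.toLin'_one]
  refine LinearMap.ext fun v => ?_
  exact Module.involutive_reflection (f.form_self i) v

open Polynomial.Chebyshev in
theorem cheb_zero {m : ℕ} (hm : 3 ≤ m) (t : ℂ)
    (ht : t = 2 * Complex.cos ((2 * Real.pi / m : ℝ) : ℂ)) :
    (S ℂ (((m : ℤ) - 2) / 2)).eval t *
      ((S ℂ (((m : ℤ) - 1) / 2)).eval t + (S ℂ (((m : ℤ) - 3) / 2)).eval t) = 0 ∧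
    (S ℂ (((m : ℤ) - 1) / 2)).eval t *
      ((S ℂ ((m : ℤ) / 2)).eval t + (S ℂ (((m : ℤ) - 2) / 2)).eval t) = 0 := by
  have hm0 : (0 : ℝ) < m := by positivity
  have hm3 : (3 : ℝ) ≤ m := by exact_mod_cast hm
  set θ : ℝ := 2 * Real.pi / m with hθ
  have hsin : Real.sin θ ≠ 0 := by
    apply ne_of_gt
    apply Real.sin_pos_of_pos_of_lt_pi
    · positivity
    · rw [hθ, div_lt_iff₀ hm0]; nlinarith [Real.pi_pos]
  have hsin' : Complex.sin (θ : ℂ) ≠ 0 := by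
    rw [← Complex.ofReal_sin]; exact_mod_cast hsin
  have hS : ∀ n : ℤ, (S ℂ n).eval t * Complex.sin θ = ((Real.sin ((n + 1) * θ) : ℝ) : ℂ) := by
    intro n
    rw [ht, S_two_mul_complex_cos]
    push_cast
    rfl
  have hmθ : (m : ℝ) * θ = 2 * Real.pi := by rw [hθ]; field_simp
  rcases Nat.even_or_odd' m with ⟨k, hk | hk⟩
  · have h1 : ((m : ℤ) - 2) / 2 = k - 1 := by omega
    have h2 : ((m : ℤ) - 1) / 2 = k - 1 := by omega
    have hz : (S ℂ ((k : ℤ) - 1)).eval t = 0 := by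
      have := hS (k - 1)
      have hkθ : ((((k : ℤ) - 1 : ℤ) : ℝ) + 1) * θ = Real.pi := by
        rw [hk] at hmθ; push_cast at hmθ ⊢; linarith
      rw [hkθ, Real.sin_pi] at this
      simpa [hsin'] using this
    rw [h1, h2, hz]
    simp
  · have h1 : ((m : ℤ) - 2) / 2 = k - 1 := by omega
    have h2 : ((m : ℤ) - 1) / 2 = k := by omega
    have h3 : ((m : ℤ) - 3) / 2 = k - 1 := by omega
    have h4 : (m : ℤ) / 2 = k := by omega
    have hz : (S ℂ (k : ℤ)).eval t + (S ℂ ((k : ℤ) - 1)).eval t = 0 := by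
      have ha := hS k
      have hb := hS (k - 1)
      have hkθ : (((k : ℤ) : ℝ) + 1) * θ = 2 * Real.pi - ((((k : ℤ) - 1 : ℤ) : ℝ) + 1) * θ := by
        rw [hk] at hmθ; push_cast at hmθ ⊢; linarith
      rw [hkθ, Real.sin_two_pi_sub] at ha
      have : ((S ℂ (k : ℤ)).eval t + (S ℂ ((k : ℤ) - 1)).eval t) * Complex.sin θ = 0 := by
        rw [add_mul, ha, hb]; push_cast; ring
      simpa [hsin'] using this
    rw [h1, h2, h3, h4, hz]
    simp

theorem omega_mul_pow (i j : B) : (f.omega i * f.omega j) ^ M i j = 1 := by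
  by_cases hij : i = j
  · subst hij
    rw [omega_mul_self, one_pow]
  by_cases h0 : M i j = 0
  · rw [h0, pow_zero]
  apply Matrix.toLin'.injective
  rw [Matrix.toLin'_pow, Matrix.toLin'_mul, toLin_omega, toLin_omega, Matrix.toLin'_one]
  have key : ((Module.reflection (f.form_self i) * Module.reflection (f.form_self j)) ^ M i j)
      = 1 := by
    by_cases h2 : M i j = 2
    · have hc : f.form i (Pi.single j 1) = 0 := by
        rw [form_single, coeff_of_two f h2]; simp [hij]
      have hc' : f.form j (Pi.single i 1) = 0 := by
        rw [form_single, coeff_of_two f (by rwa [M.symmetric])]; simp [Ne.symm hij]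
      rw [h2]
      ext1 v
      rw [pow_two]
      simp only [LinearEquiv.mul_apply, Module.reflection_apply, map_sub, map_smul,
        form_self, hc, hc', LinearEquiv.coe_one, id]
      module
    · have hm : 3 ≤ M i j := by
        have := M.off_diagonal i j hij
        change M i j ≠ 1 at this
        omega
      have ht : (2 * Complex.cos ((2 * Real.pi / (M i j : ℕ) : ℝ) : ℂ)) =
          f.form i (Pi.single j 1) * f.form j (Pi.single i 1) - 2 := by
        rw [form_single, form_single, if_neg hij, if_neg (Ne.symm hij)]
        have := f.coeff_mul_coeff (i := i) (j := j) ⟨hij, h2⟩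
        have hc : Complex.cos ((2 * Real.pi / (M i j : ℕ) : ℝ) : ℂ) =
            2 * ((Real.cos (Real.pi / (M i j : ℝ)) : ℝ) : ℂ) ^ 2 - 1 := by
          rw [mul_div_assoc]
          push_cast
          rw [Complex.cos_two_mul]
        rw [CoxeterMatrix.twoCos, if_neg h0] at this
        rw [hc]
        push_cast at this ⊢
        linear_combination -this
      have hz := cheb_zero hm _ rfl
      ext1 v
      rw [Module.reflection_mul_reflection_pow_apply _ _ _ _ _ ht, hz.1, hz.2]
      simp
  refine LinearMap.ext fun v => ?_
  have hpow : ∀ n : ℕ, (((Module.reflection (f.form_self i)).toLinearMap ∘ₗ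
      (Module.reflection (f.form_self j)).toLinearMap) ^ n) v =
      ((Module.reflection (f.form_self i) * Module.reflection (f.form_self j)) ^ n) v := by
    intro n
    induction n with
    | zero => rfl
    | succ n ih =>
      rw [pow_succ', pow_succ', Module.End.mul_apply, ih]
      rfl
  rw [hpow, key]
  rfl

/-- The matrix `ω_i` as an element of `GL_n(ℂ)`; it is its own inverse. -/
noncomputable def omegaGL (i : B) : GL B ℂ :=
  ⟨f.omega i, f.omega i, f.omega_mul_self i, f.omega_mul_self i⟩

theorem omegaGL_isLiftable : M.IsLiftable f.omegaGL :=
  fun i j => Units.ext (f.omega_mul_pow i j)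

end relations

/-- The generalized geometric representation `R_{Γ,f} : W → GL_n(ℂ)`: the homomorphism that
sends each generator `s_i` to `ω_i`. -/
noncomputable def rep {B : Type*} [Fintype B] [DecidableEq B] {M : CoxeterMatrix B}
    {W : Type*} [Group W] (cs : CoxeterSystem M W) (f : LegalWeight M) : W →* GL B ℂ :=
  cs.lift ⟨f.omegaGL, f.omegaGL_isLiftable⟩

theorem rep_simple {B : Type*} [Fintype B] [DecidableEq B] {M : CoxeterMatrix B}
    {W : Type*} [Group W] (cs : CoxeterSystem M W) (f : LegalWeight M) (i : B) :
    (rep cs f (cs.simple i) : Matrix B B ℂ) = f.omega i := by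
  rw [rep, cs.lift_apply_simple f.omegaGL_isLiftable]
  rfl

end LegalWeight

/-! Balance gives a gauge `d` with `f(i,j) * d j = d i` on edges, so in the rescaled basis `α i = d
i • e_i` the matrices `ω_i` act by the real formulas of the standard geometric representation. Tits'
argument then applies: if `i` is not a right descent of `w`, then `w` sends `α i` into the cone
spanned by `α` (`apply_root_mem_span_of_not_isRightDescent`). A nontrivial `w` in the kernel has a
right descent `i`, and `w * s_i`, which has none at `i`, sends `α i` to `-α i`, which is outside the
cone.

The cone statement is proved by induction on length: `w` is split as `v` times an alternating word
in `i` and a descent `j`, where `v` has neither descent. The word sends `α i` to a nonnegative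
combination of `α i` and `α j`, and induction applies to `v` on both. -/

/-- Adjacent values of a gauge have ratio equal to the weight of the edge. -/
theorem LegalWeight.IsBalanced.exists_gauge {B : Type*} {M : CoxeterMatrix B} {f : LegalWeight M}
    (hf : f.IsBalanced) :
    ∃ d : B → ℂˣ, ∀ i j (h : M.coxeterGraph.Adj i j), f.toFun ⟨(i, j), h⟩ * d j = d i := by
  have hr : ∀ i, M.coxeterGraph.Reachable i (M.coxeterGraph.connectedComponentMk i).out := fun i =>
    (SimpleGraph.ConnectedComponent.exact (Quot.out_eq _)).symm
  -- The gauge at `i` is the weight of a path from `i` to the chosen base point of its component.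
  refine ⟨fun i => f.pathWeight (hr i).some, fun i j h => ?_⟩
  have hij : M.coxeterGraph.connectedComponentMk i = M.coxeterGraph.connectedComponentMk j :=
    SimpleGraph.ConnectedComponent.sound h.reachable
  -- The endpoints are generalized because the base points of `i` and `j` are equal only
  -- propositionally.
  have key : ∀ (r r' : B) (_ : r = r') (p : M.coxeterGraph.Walk i r) (q : M.coxeterGraph.Walk j r'),
      f.toFun ⟨(i, j), h⟩ * f.pathWeight q = f.pathWeight p := by
    rintro r _ rfl p q
    have hinv : f.pathWeight p.reverse * f.pathWeight p = 1 := by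
      have := hf _ (p.reverse.append p)
      simpa [LegalWeight.pathWeight] using this
    have h1 := hf _ (p.reverse.append (SimpleGraph.Walk.cons h q))
    have h2 : f.pathWeight p.reverse * (f.toFun ⟨(i, j), h⟩ * f.pathWeight q) = 1 := by
      simpa [LegalWeight.pathWeight] using h1
    exact mul_left_cancel (h2.trans hinv.symm)
  exact key _ _ (by rw [hij]) _ _

/-! ### Coefficients of dihedral roots -/

theorem CoxeterMatrix.twoCos_comm {B : Type*} (M : CoxeterMatrix B) (i j : B) :
    M.twoCos i j = M.twoCos j i := by
  simp [CoxeterMatrix.twoCos, M.symmetric j i]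

/-- The coefficients of the roots of a dihedral root system, given by their recurrence,
are nonnegative up to the order of the product of the two generators. -/
theorem CoxeterMatrix.exists_twoCos_recurrence {B : Type*} (M : CoxeterMatrix B) {i j : B}
    (hij : i ≠ j) :
    ∃ p : ℕ → ℝ, p 0 = 0 ∧ p 1 = 1 ∧ (∀ k, p (k + 2) = M.twoCos i j * p (k + 1) - p k) ∧
      ∀ k, M i j = 0 ∨ k ≤ M i j → 0 ≤ p k := by
  by_cases h0 : M i j = 0
  · refine ⟨fun k => k, by simp, by simp, fun k => ?_, fun k _ => by positivity⟩
    rw [CoxeterMatrix.twoCos, if_pos h0]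
    push_cast
    ring
  have h1 : M i j ≠ 1 := M.off_diagonal i j hij
  have hm : (2 : ℝ) ≤ M i j := by
    have : 2 ≤ M i j := by omega
    exact_mod_cast this
  have hm0 : (0 : ℝ) < M i j := by linarith
  set θ : ℝ := Real.pi / M i j with hθ
  have hθ0 : 0 < θ := div_pos Real.pi_pos hm0
  have hmθ : M i j * θ = Real.pi := by rw [hθ]; field_simp
  have hsin : 0 < Real.sin θ :=
    Real.sin_pos_of_pos_of_lt_pi hθ0 (by nlinarith)
  -- The recurrence is the addition formula for the sine; the quotient is nonnegative as long as `k
  -- * θ ≤ π`.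
  refine ⟨fun k => Real.sin (k * θ) / Real.sin θ, by simp, by simp [hsin.ne'], fun k => ?_,
    fun k hk => ?_⟩
  · rw [CoxeterMatrix.twoCos, if_neg h0, ← hθ]
    beta_reduce
    have e2 : ((k + 2 : ℕ) : ℝ) * θ = (k + 1 : ℕ) * θ + θ := by push_cast; ring
    have e0 : (k : ℝ) * θ = (k + 1 : ℕ) * θ - θ := by push_cast; ring
    rw [e2, e0, Real.sin_add, Real.sin_sub]
    ring
  · have hk' : (k : ℝ) ≤ M i j := by exact_mod_cast hk.resolve_left h0
    refine div_nonneg (Real.sin_nonneg_of_nonneg_of_le_pi (by positivity) ?_) hsin.le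
    rw [← hmθ]
    gcongr

/-! ### Positivity of roots and Tits' argument -/

namespace CoxeterSystem

variable {B W V : Type*} [Group W] {M : CoxeterMatrix B} (cs : CoxeterSystem M W)
  [AddCommGroup V] [Module ℝ V] {ρ : Representation ℝ W V} {α : B → V}

/-- Each prepended letter changes only the coefficient of its own root, from `p k` to `M.twoCos i j
* p (k + 1) - p k`, which is `p (k + 2)`. -/
theorem apply_alternatingWord_root (hself : ∀ i, ρ (cs.simple i) (α i) = -α i)
    (hne : ∀ i j, i ≠ j → ρ (cs.simple i) (α j) = α j + M.twoCos i j • α i)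
    {i j : B} (hij : i ≠ j) {p : ℕ → ℝ} (hp0 : p 0 = 0) (hp1 : p 1 = 1)
    (hp : ∀ k, p (k + 2) = M.twoCos i j * p (k + 1) - p k) (k : ℕ) :
    ρ (cs.wordProd (alternatingWord i j k)) (α i) =
      if Even k then p (k + 1) • α i + p k • α j else p k • α i + p (k + 1) • α j := by
  induction k with
  | zero => simp [alternatingWord, hp0, hp1]
  | succ k ih =>
    rw [alternatingWord_succ', wordProd_cons, map_mul, Module.End.mul_apply, ih]
    by_cases hk : Even k
    · have hk' : ¬ Even (k + 1) := by simpa [Nat.even_add_one] using hk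
      simp only [hk, hk', if_true, if_false, map_add, map_smul, hself, hne j i hij.symm, hp,
        M.twoCos_comm j i]
      module
    · have hk' : Even (k + 1) := by simpa [Nat.even_add_one] using hk
      simp only [hk, hk', if_true, if_false, map_add, map_smul, hself, hne i j hij, hp]
      module

/-- Every element factors, with additive lengths, as an element without right descents at `i`
and `j` times an alternating word in `i` and `j` ending in `j`. -/
theorem exists_alternatingWord_factorization (w : W) (i j : B) :
    ∃ (v : W) (k : ℕ), w = v * cs.wordProd (alternatingWord i j k) ∧
      cs.length w = cs.length v + k ∧ (cs.IsRightDescent w j → 0 < k) ∧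
      (0 < k → ¬ cs.IsRightDescent v i ∧ ¬ cs.IsRightDescent v j) := by
  classical
  -- `P k` says that stripping the alternating word of length `k` from the right lowers the length
  -- by exactly `k`; the largest such `k` is taken.
  set P : ℕ → Prop := fun k =>
    cs.length (w * (cs.wordProd (alternatingWord i j k))⁻¹) + k = cs.length w with hP
  have hP0 : P 0 := by simp [hP, alternatingWord]
  have hle : ∀ k, P k → k ≤ cs.length w := fun k hk => by simp only [hP] at hk; omega
  set k := Nat.findGreatest P (cs.length w)
  have hk : P k := Nat.findGreatest_spec (Nat.zero_le _) hP0
  have hmax : ∀ l, P l → l ≤ k := fun l hl => Nat.le_findGreatest (hle l hl) hl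
  have hstep : ∀ l, w * (cs.wordProd (alternatingWord i j (l + 1)))⁻¹ =
      w * (cs.wordProd (alternatingWord i j l))⁻¹ * cs.simple (if Even l then j else i) := by
    intro l
    rw [alternatingWord_succ', wordProd_cons, mul_inv_rev, cs.inv_simple, mul_assoc]
  refine ⟨w * (cs.wordProd (alternatingWord i j k))⁻¹, k, by simp, hk.symm, fun hj => ?_,
    fun hpos => ?_⟩
  · refine hmax 1 ?_
    rw [cs.isRightDescent_iff] at hj
    simpa [hP, alternatingWord] using hj
  · have hnext : ¬ cs.IsRightDescent (w * (cs.wordProd (alternatingWord i j k))⁻¹)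
        (if Even k then j else i) := by
      intro hd
      rw [cs.isRightDescent_iff, ← hstep] at hd
      have := hmax (k + 1) (by simp only [hP] at hk ⊢; omega)
      omega
    obtain ⟨l, hl⟩ : ∃ l, k = l + 1 := ⟨k - 1, by omega⟩
    -- A descent at the letter stripped last would let `w` be written with fewer than `cs.length w`
    -- letters.
    have hprev : ¬ cs.IsRightDescent (w * (cs.wordProd (alternatingWord i j k))⁻¹)
        (if Even k then i else j) := by
      have hletter : (if Even k then i else j) = if Even l then j else i := by
        by_cases he : Even l <;> simp [hl, Nat.even_add_one, he, -Nat.not_even_iff_odd]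
      intro hd
      rw [hletter, CoxeterSystem.IsRightDescent, hl, hstep, cs.simple_mul_simple_cancel_right,
        ← hstep, ← hl] at hd
      have h1 := cs.length_mul_le (w * (cs.wordProd (alternatingWord i j l))⁻¹)
        (cs.wordProd (alternatingWord i j l))
      have h2 := cs.length_wordProd_le (alternatingWord i j l)
      rw [inv_mul_cancel_right] at h1
      rw [length_alternatingWord] at h2
      simp only [hP] at hk
      omega
    by_cases he : Even k
    · rw [if_pos he] at hnext hprev
      exact ⟨hprev, hnext⟩
    · rw [if_neg he] at hnext hprev
      exact ⟨hnext, hprev⟩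

/-- If `i` is not a right descent of `w`, then `w` sends the `i`-th simple root to a nonnegative
combination of simple roots. -/
theorem apply_root_mem_span_of_not_isRightDescent
    (hself : ∀ i, ρ (cs.simple i) (α i) = -α i)
    (hne : ∀ i j, i ≠ j → ρ (cs.simple i) (α j) = α j + M.twoCos i j • α i)
    (w : W) (i : B) (hw : ¬ cs.IsRightDescent w i) :
    ρ w (α i) ∈ Submodule.span NNReal (Set.range α) := by
  induction hn : cs.length w using Nat.strong_induction_on generalizing w i with
  | _ n ih =>
  subst hn
  by_cases hw1 : w = 1
  · subst hw1
    simpa using Submodule.subset_span (Set.mem_range_self i)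
  obtain ⟨j, hj⟩ := cs.exists_rightDescent_of_ne_one hw1
  have hij : i ≠ j := by
    rintro rfl
    exact hw hj
  obtain ⟨v, k, hwv, hlen, hpos, hv⟩ := cs.exists_alternatingWord_factorization w i j
  have hk := hpos hj
  obtain ⟨hvi, hvj⟩ := hv hk
  have hi' := ih (cs.length v) (by omega) v i hvi rfl
  have hj' := ih (cs.length v) (by omega) v j hvj rfl
  -- As `i` is not a descent of `w`, the product `w * s_i = v * (⋯ s_j s_i)` has length `cs.length v
  -- + k + 1`. So the alternating word of length `k + 1` is reduced, which bounds `k + 1` by a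
  -- finite `M i j`.
  have hkm : M i j = 0 ∨ k + 1 ≤ M i j := by
    by_contra! hcon
    have hM : M j i ≠ 0 := by rw [M.symmetric]; exact hcon.1
    refine cs.not_isReduced_alternatingWord j i hM (m := k + 1)
      (by rw [M.symmetric]; omega) ?_
    have h1 := cs.length_wordProd_le (alternatingWord j i (k + 1))
    rw [cs.not_isRightDescent_iff] at hw
    have h2 := cs.length_mul_le v (cs.wordProd (alternatingWord j i (k + 1)))
    rw [alternatingWord_succ, wordProd_concat, ← mul_assoc, ← hwv, ← wordProd_concat,
      ← alternatingWord_succ] at h2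
    rw [length_alternatingWord] at h1
    rw [CoxeterSystem.IsReduced, length_alternatingWord]
    omega
  obtain ⟨p, hp0, hp1, hp, hnn⟩ := M.exists_twoCos_recurrence hij
  have a : 0 ≤ p k := hnn k (by omega)
  have b : 0 ≤ p (k + 1) := hnn (k + 1) hkm
  rw [hwv, map_mul, Module.End.mul_apply,
    cs.apply_alternatingWord_root hself hne hij hp0 hp1 hp k]
  have smul_mem : ∀ {r : ℝ} {x : V}, 0 ≤ r → x ∈ Submodule.span NNReal (Set.range α) →
      r • x ∈ Submodule.span NNReal (Set.range α) := fun {r x} hr hx =>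
    Submodule.smul_mem _ (⟨r, hr⟩ : NNReal) hx
  split_ifs
  · rw [map_add, map_smul, map_smul]
    exact add_mem (smul_mem b hi') (smul_mem a hj')
  · rw [map_add, map_smul, map_smul]
    exact add_mem (smul_mem a hi') (smul_mem b hj')

/-- A representation acting on simple roots by the Coxeter formulas is faithful as soon as no
opposite of a simple root is a nonnegative combination of simple roots. -/
theorem injective_of_apply_root (hself : ∀ i, ρ (cs.simple i) (α i) = -α i)
    (hne : ∀ i j, i ≠ j → ρ (cs.simple i) (α j) = α j + M.twoCos i j • α i)
    (hα : ∀ i, -α i ∉ Submodule.span NNReal (Set.range α)) :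
    Function.Injective ρ := by
  rw [injective_iff_map_eq_one]
  intro w hw
  by_contra hw1
  obtain ⟨i, hi⟩ := cs.exists_rightDescent_of_ne_one hw1
  have hi' := cs.isRightDescent_iff_not_isRightDescent_mul.mp hi
  have := cs.apply_root_mem_span_of_not_isRightDescent hself hne _ i hi'
  rw [map_mul, hw, one_mul, hself] at this
  exact hα i this

end CoxeterSystem

/-! ### Passage to the rescaled basis -/

theorem LegalWeight.omega_mulVec_single {B : Type*} [Fintype B] [DecidableEq B]
    {M : CoxeterMatrix B} (f : LegalWeight M) (i j : B) (c : ℂ) :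
    (f.omega i).mulVec (Pi.single j c) =
      Pi.single j c - Pi.single i (c * ((if i = j then 2 else 0) - f.coeff i j)) := by
  have h : (Pi.single j c : B → ℂ) = c • Pi.single j 1 := by
    rw [← Pi.single_smul, smul_eq_mul, mul_one]
  rw [← Matrix.toLin'_apply, f.toLin_omega, LinearEquiv.coe_coe, Module.reflection_apply]
  conv_lhs => rw [h, map_smul, f.form_single, ← h]
  rw [← Pi.single_smul, smul_eq_mul, smul_eq_mul, mul_one]

/-- Balanced weights turn into the standard ones after rescaling the basis by a gauge. -/
theorem LegalWeight.coeff_mul_gauge {B : Type*} {M : CoxeterMatrix B} (f : LegalWeight M)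
    {d : B → ℂˣ} (hd : ∀ i j (h : M.coxeterGraph.Adj i j), f.toFun ⟨(i, j), h⟩ * d j = d i)
    {i j : B} (hij : i ≠ j) : f.coeff i j * d j = M.twoCos i j * d i := by
  by_cases h : M.coxeterGraph.Adj i j
  · rw [LegalWeight.coeff, dif_pos h, ← hd i j h, Units.val_mul]
    ring
  · have h2 : M i j = 2 := by
      by_contra h2
      exact h ⟨hij, h2⟩
    rw [f.coeff_of_two h2, CoxeterMatrix.twoCos, h2]
    simp

theorem mainTheorem2 {B : Type*} [Fintype B] [DecidableEq B] (M : CoxeterMatrix B)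
    {W : Type*} [Group W] (cs : CoxeterSystem M W) (f : LegalWeight M) (hf : f.IsBalanced) :
    Function.Injective (LegalWeight.rep cs f) := by
  obtain ⟨d, hd⟩ := hf.exists_gauge
  let ρ : Representation ℝ W (B → ℂ) :=
    { toFun := fun w =>
        (Matrix.toLin' (LegalWeight.rep cs f w : Matrix B B ℂ)).restrictScalars ℝ
      map_one' := by ext; simp
      map_mul' := fun x y => by ext; simp }
  let α : B → B → ℂ := fun i => Pi.single i (d i : ℂ)
  have hρ : ∀ i v, ρ (cs.simple i) v = (f.omega i).mulVec v := fun i v => by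
    rw [← LegalWeight.rep_simple cs f i]
    rfl
  have hself : ∀ i, ρ (cs.simple i) (α i) = -α i := fun i => by
    rw [hρ, f.omega_mulVec_single, if_pos rfl, f.coeff_self, ← Pi.single_sub, ← Pi.single_neg]
    congr 1
    ring
  have hne : ∀ i j, i ≠ j → ρ (cs.simple i) (α j) = α j + M.twoCos i j • α i := fun i j hij => by
    rw [hρ, f.omega_mulVec_single, if_neg hij, zero_sub, mul_neg, mul_comm,
      f.coeff_mul_gauge hd hij, Pi.single_neg, sub_neg_eq_add, ← Pi.single_smul,
      Complex.real_smul]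
  -- In the cone every coordinate `i` is a nonnegative multiple of `d i`, whereas that of `-α i` is
  -- `-d i`.
  have hspan : ∀ x ∈ Submodule.span NNReal (Set.range α), ∀ i,
      ∃ r : NNReal, x i = r • (d i : ℂ) := by
    intro x hx i
    induction hx using Submodule.span_induction with
    | mem x hx =>
      obtain ⟨j, rfl⟩ := hx
      by_cases hij : i = j
      · subst hij
        exact ⟨1, by simp [α]⟩
      · exact ⟨0, by simp [α, hij]⟩
    | zero => exact ⟨0, by simp⟩
    | add x y _ _ hx hy =>
      obtain ⟨r, hr⟩ := hx
      obtain ⟨s, hs⟩ := hy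
      exact ⟨r + s, by rw [Pi.add_apply, hr, hs, add_smul]⟩
    | smul c x _ hx =>
      obtain ⟨r, hr⟩ := hx
      exact ⟨c * r, by rw [Pi.smul_apply, hr, mul_smul]⟩
  have hα : ∀ i, -α i ∉ Submodule.span NNReal (Set.range α) := by
    intro i hi
    obtain ⟨r, hr⟩ := hspan _ hi i
    have h1 : ((r : ℝ) : ℂ) = -1 := by
      refine mul_right_cancel₀ (d i).ne_zero ?_
      rw [neg_one_mul, ← Complex.real_smul, ← NNReal.smul_def, ← hr]
      simp [α]
    have h2 : (r : ℝ) = -1 := by exact_mod_cast h1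
    linarith [r.coe_nonneg]
  have hinj := cs.injective_of_apply_root (ρ := ρ) hself hne hα
  intro x y hxy
  refine hinj ?_
  change (Matrix.toLin' _).restrictScalars ℝ = (Matrix.toLin' _).restrictScalars ℝ
  rw [hxy]
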